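/- **Conventions.** Let $L$ be a countable language with only function symbols (constants included) and let $\mathbf V$ be a variety of $L$-algebras. A $\mathbf V$-free algebra of rank $\lambda$ is an algebra of $\mathbf V$ freely generated in $\mathbf V$ by a set of size $\lambda$ (rank $0$ is allowed). $\mathcal F_{\mathbf V}$, $\mathcal F^{\infty}_{\mathbf V}$, $\mathcal F^{<\infty}_{\mathbf V}$ are the classes of $\mathbf V$-free algebras, of those of infinite rank, and of those of finite rank. $A*C$ and $B*_AC$ denote the coproduct and the pushout over $A$ in $\mathbf V$; $\le$ is the substructure relation. For $A,B\in\mathcal F_{\mathbf V}$, $A\leqslant_*^{\rm ff}B$ means that $B=A*C$ (as an internal free product) for some $C\in\mathcal F_{\mathbf V}$. $\mathbf V$ satisfies the *Construction Principle* if there are countable $A\le B$ in $\mathcal F^\infty_{\mathbf V}$ with $A$ freely generated by $\{a_i:i<\omega\}$ such that $\langle a_j:j\le i\rangle_B\leqslant_*^{\rm ff}B$ for every $i<\omega$, and $A\not\leqslant_*^{\rm ff}B*C$ for every $C\in\mathcal F_{\mathbf V}$. An *AEC-covering* of $(\mathcal F_{\mathbf V},\leqslant_*^{\rm ff})$ is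 an abstract elementary class $(\mathcal K,\preccurlyeq)$ of $L$-structures with the amalgamation and joint embedding properties such that $\mathcal F^\infty_{\mathbf V}\subseteq\mathcal K$ and, for $A,B\in\mathcal F_{\mathbf V}\cap\mathcal K$, $A\leqslant_*^{\rm ff}B$ implies $A\preccurlyeq B$. Let $\kappa>\mathrm{LS}(\mathcal K,\preccurlyeq)$, and let $\mathfrak M\in\mathcal K$ be a *monster model*: every $C\in\mathcal K$ with $|C|\le\kappa$ embeds strongly in $\mathfrak M$, and every isomorphism between strong submodels of $\mathfrak M$ of size $<\kappa$ extends to an automorphism of $\mathfrak M$. Below, "model" means a strong submodel of $\mathfrak M$ of size $<\kappa$, and $\mathrm{tp}(\bar a/A)=\mathrm{tp}(\bar b/A)$ means that some automorphism of $\mathfrak M$ fixing $A$ pointwise maps $\bar a$ to $\bar b$. A *weak independence calculus* is a relation $\bar a\perp_{A}B$ between finite tuples $\bar a$ of $\mathfrak M$ and models $A\preccurlyeq B$ such that: 1. (Invariance) if $\bar a\perp_AB$ and $f\in\mathrm{Aut}(\mathfrak M)$, then $f(\bar a)\perp_{f(A)}f(B)$; 2. (Disjointness) if $\bar a\perp_AB$,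 then $\bar a\in B$ iff $\bar a\in A$; 3. (Symmetry) if $\bar b\perp_{A_0}A_1$ and $\bar a\in A_1$, there is a model $A_2\succcurlyeq A_0$ with $\bar b\in A_2$ and $\bar a\perp_{A_0}A_2$; 4. (Monotonicity) if $A\preccurlyeq A'\preccurlyeq B'\preccurlyeq B$ and $\bar a\perp_AB$, then $\bar a\perp_{A'}B'$; 5. (Existence) for $A\preccurlyeq B$ and every $\bar a$ there is $\bar b$ with $\mathrm{tp}(\bar b/A)=\mathrm{tp}(\bar a/A)$ and $\bar b\perp_AB$; 6. (Uniqueness) if $\bar a\perp_AB$, $\bar b\perp_AB$ and $\mathrm{tp}(\bar a/A)=\mathrm{tp}(\bar b/A)$, then $\mathrm{tp}(\bar a/B)=\mathrm{tp}(\bar b/B)$; 7. (Continuity) if $\delta$ is a limit ordinal, $(A_i)_{i\le\delta}$ is an increasing continuous $\preccurlyeq$-chain of models, and $\bar a_i\perp_{A_0}A_i$ and $\mathrm{tp}(\bar a_i/A_i)=\mathrm{tp}(\bar a/A_i)$ for all $i<\delta$, then $\bar a\perp_{A_0}A_\delta$. It is *superstable* if moreover for every limit ordinal $\delta$, every increasing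 continuous $\preccurlyeq$-chain $(A_i)_{i\le\delta}$ of models and every finite tuple $\bar a$ of $\mathfrak M$ there is $\alpha<\delta$ with $\bar a\perp_{A_\alpha}A_\delta$. For models $A,B,C$ write $B\perp_AC$ if $\bar b\perp_AC$ for every finite tuple $\bar b$ of $B$, and $B\perp^*_AC$ if $\langle B,C\rangle_{\mathfrak M}=B*_AC$ (as an internal free amalgam) and $\langle B,C\rangle_{\mathfrak M}\preccurlyeq\mathfrak M$. The calculus is *nice with respect to free factors* if: - $(\star_1)$ there is $n_*<\omega$ such that the $\mathbf V$-free algebras of rank $m$ are in $\mathcal K$ whenever $n_*\le m<\omega$; - $(\star_2)$ there is $m_*<\omega$ such that, for all models $A,B,C\in\mathcal F_{\mathbf V}$ with $A\leqslant_*^{\rm ff}B$, $A\leqslant_*^{\rm ff}C$ and $A$ of rank at least $m_*$, $B\perp_AC$ iff $B\perp^*_AC$; - $(\star_3)$ for all models $A\in\mathcal F^{<\infty}_{\mathbf V}$ and $B,C\in\mathcal F_{\mathbf V}$ with $A\preccurlyeq B$ and $A\leqslant_*^{\rm ff}C$, and every $c\in C$ with $c\perp_AB$, there is $D\in\mathcal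 F^{<\infty}_{\mathbf V}$ with $c\in D$, $A\leqslant_*^{\rm ff}D\leqslant_*^{\rm ff}C$ and $D\perp_AB$; - $(\star_4)$ for all models $A,B,C\in\mathcal F^{<\infty}_{\mathbf V}$ and $D\in\mathcal F_{\mathbf V}$ with $A\leqslant_*^{\rm ff}B\leqslant_*^{\rm ff}D$, $A\leqslant_*^{\rm ff}C\leqslant_*^{\rm ff}D$ and $B\perp_AC$, one has $\langle B,C\rangle_{\mathfrak M}=B*_AC\leqslant_*^{\rm ff}D$. **Theorem.** Let $\mathbf V$ be a variety in a countable language satisfying the Construction Principle, and let $(\mathcal K,\preccurlyeq)$ be an AEC-covering of $(\mathcal F_{\mathbf V},\leqslant_*^{\rm ff})$ with a weak independence calculus $\perp$ (in a monster model $\mathfrak M$ as above) which is nice with respect to free factors. Then $\perp$ is not superstable. -/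

import Mathlib

open FirstOrder Cardinal

universe u v w

/-! ### Varieties of algebras and their free objects -/

/-- A variety of algebras in the language `L`, presented by its identities.  (The language is
assumed to be algebraic wherever a variety occurs in the theorem.) -/
structure AlgVariety (L : FirstOrder.Language.{v, w}) where
  identities : Set (L.Term ℕ × L.Term ℕ)

namespace AlgVariety

variable {L : FirstOrder.Language.{v, w}} (V : AlgVariety L)

/-- The algebra `M` belongs to the variety `V`. -/
def Mem (M : Type u) [L.Structure M] : Prop :=
  ∀ e ∈ V.identities, ∀ x : ℕ → M, e.1.realize x = e.2.realize x

/-- `M` is an algebra of `V`, freely generated in `V` by the set `X`. -/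
def IsBasis (M : Type u) [L.Structure M] (X : Set M) : Prop :=
  V.Mem M ∧ FirstOrder.Language.Substructure.closure L X = ⊤ ∧
    ∀ (N : Type u) [L.Structure N], V.Mem N →
      ∀ f : X → N, ∃ h : M →[L] N, ∀ x : X, h x = f x

/-- `M` is a `V`-free algebra (of some rank, possibly `0`). -/
def IsFree (M : Type u) [L.Structure M] : Prop :=
  ∃ X : Set M, V.IsBasis M X

/-- `M` is a `V`-free algebra of infinite rank. -/
def IsFreeInf (M : Type u) [L.Structure M] : Prop :=
  ∃ X : Set M, V.IsBasis M X ∧ X.Infinite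

/-- `M` is a `V`-free algebra of finite rank. -/
def IsFreeFin (M : Type u) [L.Structure M] : Prop :=
  ∃ X : Set M, V.IsBasis M X ∧ X.Finite

/-- `M` is a `V`-free algebra of rank `m`. -/
def IsFreeOfRank (M : Type u) [L.Structure M] (m : ℕ) : Prop :=
  ∃ X : Set M, V.IsBasis M X ∧ X.encard = m

/-- `M` is a `V`-free algebra of rank at least `m`. -/
def IsFreeOfRankGE (M : Type u) [L.Structure M] (m : ℕ) : Prop :=
  ∃ X : Set M, V.IsBasis M X ∧ (m : ℕ∞) ≤ X.encard

/-- Inside an ambient structure `M`: the substructure `P` is the free product `A * C` in `V` of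
its substructures `A` and `C`, i.e. it is their coproduct in `V` along the inclusions.
(Uniqueness of the mediating map is automatic, as `P` is generated by `A` and `C`.) -/
def IsFreeProduct {M : Type u} [L.Structure M] (A C P : L.Substructure M) : Prop :=
  V.Mem P ∧ A ⊔ C = P ∧
    ∀ (N : Type u) [L.Structure N], V.Mem N → ∀ (f : A →[L] N) (g : C →[L] N),
      ∃ h : P →[L] N,
        (∀ (x : M) (hA : x ∈ A) (hP : x ∈ P), h ⟨x, hP⟩ = f ⟨x, hA⟩) ∧
        (∀ (x : M) (hC : x ∈ C) (hP : x ∈ P), h ⟨x, hP⟩ = g ⟨x, hC⟩)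

/-- Inside an ambient structure `M`: the substructure `P` is the free product `B *_A C` in `V` of
its substructures `B` and `C` with amalgamated common substructure `A`, i.e. it is the pushout
in `V` of the inclusions of `A` in `B` and `C`. -/
def IsFreeAmalgam {M : Type u} [L.Structure M] (A B C P : L.Substructure M) : Prop :=
  A ≤ B ∧ A ≤ C ∧ V.Mem P ∧ B ⊔ C = P ∧
    ∀ (N : Type u) [L.Structure N], V.Mem N → ∀ (f : B →[L] N) (g : C →[L] N),
      (∀ (x : M) (hB : x ∈ B) (hC : x ∈ C), x ∈ A → f ⟨x, hB⟩ = g ⟨x, hC⟩) →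
      ∃ h : P →[L] N,
        (∀ (x : M) (hB : x ∈ B) (hP : x ∈ P), h ⟨x, hP⟩ = f ⟨x, hB⟩) ∧
        (∀ (x : M) (hC : x ∈ C) (hP : x ∈ P), h ⟨x, hP⟩ = g ⟨x, hC⟩)

/-- The free algebra `A` is a free factor of the free algebra `B` with a free complementary
factor: `B = A * C` for some free algebra `C`. -/
def FreeFactor {M : Type u} [L.Structure M] (A B : L.Substructure M) : Prop :=
  V.IsFree A ∧ V.IsFree B ∧ ∃ C : L.Substructure M, V.IsFree C ∧ V.IsFreeProduct A C B

/-- The Construction Principle: there are countable free algebras `A ≤ B` of infinite rank with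
`A` freely generated by `a 0, a 1, …`, such that every `⟨a j : j ≤ i⟩` is a free factor of `B`
(with free complement), but `A` is not a free factor of `B * C`, for any free algebra `C`.
The free product `B * C` is any algebra `P` which is the internal free product of an embedded
copy of `B` and a free subalgebra `C`. -/
def ConstructionPrinciple : Prop :=
  ∃ (B : Type u) (_ : L.Structure B) (A : L.Substructure B) (a : ℕ → A),
    Countable B ∧ V.IsFreeInf B ∧
    Function.Injective a ∧ V.IsBasis A (Set.range a) ∧
    (∀ i : ℕ, V.FreeFactor
      (FirstOrder.Language.Substructure.closure L {x : B | ∃ j ≤ i, x = (a j : B)}) ⊤) ∧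
    ∀ (P : Type u) [L.Structure P] (f : B ↪[L] P) (C : L.Substructure P),
      V.IsFree C → V.IsFreeProduct f.toHom.range C ⊤ →
        ¬ V.FreeFactor (A.map f.toHom) ⊤

end AlgVariety

/-! ### Abstract elementary classes -/

/-- A class of `L`-structures together with a relation between structures and their
substructures: `mem M` says that `M` is in the class, `strong M A` that `A ≼ M`. -/
structure StrongClass (L : FirstOrder.Language.{v, w}) where
  mem : ∀ (M : Type u) [L.Structure M], Prop
  strong : ∀ (M : Type u) [L.Structure M], L.Substructure M → Prop

namespace StrongClass

variable {L : FirstOrder.Language.{v, w}} (K : StrongClass.{u} L)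

/-- `A ≼ B` for two substructures `A`, `B` of an ambient structure. -/
def StrongIn {M : Type u} [L.Structure M] (A B : L.Substructure M) : Prop :=
  A ≤ B ∧ K.strong B (A.comap B.subtype.toHom)

/-- A strong embedding: its image is a strong substructure. -/
def IsStrongEmbedding {M N : Type u} [L.Structure M] [L.Structure N] (f : M ↪[L] N) : Prop :=
  K.strong N f.toHom.range

/-- `(A i)_{i < δ}` is an increasing continuous `≼`-chain of structures in `K`
(the values `A i` for `i ≥ δ` are irrelevant). -/
structure IsContinuousChain {M : Type u} [L.Structure M] (δ : Ordinal.{u})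
    (A : Ordinal.{u} → L.Substructure M) : Prop where
  mem : ∀ i < δ, K.mem (A i)
  strongIn : ∀ i j, i ≤ j → j < δ → K.StrongIn (A i) (A j)
  continuous : ∀ j < δ, Order.IsSuccLimit j → (A j : Set M) = ⋃ i < j, (A i : Set M)

/-- `lam` is a Löwenheim-Skolem number of `K`. -/
def IsLSNumber (lam : Cardinal.{u}) : Prop :=
  ℵ₀ ≤ lam ∧ Cardinal.lift.{u} L.card ≤ Cardinal.lift.{max v w} lam ∧
    ∀ (M : Type u) [L.Structure M], K.mem M → ∀ X : Set M,
      ∃ C : L.Substructure M, X ⊆ C ∧ K.strong M C ∧ #C ≤ #X + lam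

/-- `K` is an abstract elementary class.  That `A ≼ M` implies that `A` is a substructure of `M`
is built into the type of `K.strong`, and so is antisymmetry. -/
structure IsAEC : Prop where
  mem_of_strong : ∀ (M : Type u) [L.Structure M] (A : L.Substructure M),
    K.strong M A → K.mem M ∧ K.mem A
  mem_iso : ∀ (M N : Type u) [L.Structure M] [L.Structure N], (M ≃[L] N) → K.mem M → K.mem N
  strong_iso : ∀ (M N : Type u) [L.Structure M] [L.Structure N] (f : M ≃[L] N)
    (A : L.Substructure M), K.strong M A → K.strong N (A.map f.toHom)
  refl : ∀ (M : Type u) [L.Structure M], K.mem M → K.strong M ⊤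
  trans : ∀ (M : Type u) [L.Structure M] (A B : L.Substructure M),
    K.StrongIn A B → K.strong M B → K.strong M A
  /-- The Tarski-Vaught axioms; `U` is the union of the chain. -/
  union : ∀ (M : Type u) [L.Structure M] (δ : Ordinal.{u}) (A : Ordinal.{u} → L.Substructure M)
    (U : L.Substructure M), Order.IsSuccLimit δ → K.IsContinuousChain δ A →
    (U : Set M) = ⋃ i < δ, (A i : Set M) →
      K.mem U ∧ (∀ j < δ, K.StrongIn (A j) U) ∧
      ((∀ i < δ, K.strong M (A i)) → K.strong M U)
  coherence : ∀ (M : Type u) [L.Structure M] (A B : L.Substructure M),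
    K.strong M A → K.strong M B → A ≤ B → K.StrongIn A B
  exists_isLSNumber : ∃ lam : Cardinal.{u}, K.IsLSNumber lam

/-- The amalgamation property. -/
def AP : Prop :=
  ∀ (A B C : Type u) [L.Structure A] [L.Structure B] [L.Structure C]
    (f : A ↪[L] B) (g : A ↪[L] C), K.mem A → K.IsStrongEmbedding f → K.IsStrongEmbedding g →
    ∃ (D : Type u) (_ : L.Structure D) (f' : B ↪[L] D) (g' : C ↪[L] D),
      K.IsStrongEmbedding f' ∧ K.IsStrongEmbedding g' ∧ ∀ x, f' (f x) = g' (g x)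

/-- The joint embedding property. -/
def JEP : Prop :=
  ∀ (B C : Type u) [L.Structure B] [L.Structure C], K.mem B → K.mem C →
    ∃ (D : Type u) (_ : L.Structure D) (f : B ↪[L] D) (g : C ↪[L] D),
      K.IsStrongEmbedding f ∧ K.IsStrongEmbedding g

/-- `(K, ≼)` is an AEC-covering of the free algebras of `V` with the relation of being a free
factor with free complement. -/
structure IsAECCovering (V : AlgVariety L) : Prop where
  mem_of_isFreeInf : ∀ (M : Type u) [L.Structure M], V.IsFreeInf M → K.mem M
  isAEC : K.IsAEC
  strongIn_of_freeFactor : ∀ (M : Type u) [L.Structure M] (A B : L.Substructure M),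
    K.mem A → K.mem B → V.FreeFactor A B → K.StrongIn A B
  ap : K.AP
  jep : K.JEP

/-! ### The monster model and independence calculi -/

/-- `M` is a `(κ, ≼)`-universal and `(κ, ≼)`-homogeneous model in `K`. -/
structure IsMonster (κ : Cardinal.{u}) (M : Type u) [L.Structure M] : Prop where
  mem : K.mem M
  universal : ∀ (C : Type u) [L.Structure C], K.mem C → #C ≤ κ →
    ∃ f : C ↪[L] M, K.IsStrongEmbedding f
  homogeneous : ∀ (A₀ A₁ : L.Substructure M), K.strong M A₀ → K.strong M A₁ →
    #A₀ < κ → #A₁ < κ → ∀ f : A₀ ≃[L] A₁, ∃ π : M ≃[L] M, ∀ x : A₀, π x = f x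

/-- `A` is a strong submodel of `M` of size less than `κ`.  As usual when working in a monster
model, "strong submodel of the monster" refers to these. -/
def Small (κ : Cardinal.{u}) {M : Type u} [L.Structure M] (A : L.Substructure M) : Prop :=
  K.strong M A ∧ #A < κ

end StrongClass

/-- The tuples `a` and `b` have the same Galois type over `A` in the monster model `M`: they are
in the same orbit of the automorphisms of `M` that fix `A` pointwise. -/
def SameGaloisType {L : FirstOrder.Language.{v, w}} {M : Type u} [L.Structure M] {n : ℕ}
    (A : L.Substructure M) (a b : Fin n → M) : Prop :=
  ∃ f : M ≃[L] M, (∀ x ∈ A, f x = x) ∧ ∀ i, f (a i) = b i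

/-- A ternary relation between finite tuples of `M` and two substructures of `M`;
`ind a A B` stands for: `a` is independent from `B` over `A`. -/
abbrev TernaryRel (L : FirstOrder.Language.{v, w}) (M : Type u) [L.Structure M] : Type u :=
  ∀ ⦃n : ℕ⦄, (Fin n → M) → L.Substructure M → L.Substructure M → Prop

/-- `(K, ≼, ind)` is a weak independence calculus, computed in the monster model `M`.  The
relation is only considered for tuples and pairs `A₀ ≼ A₁` of (small) strong submodels of `M`.
By coherence, `A₀ ≼ A₁` amounts to `A₀ ≤ A₁` for such submodels. -/
structure IsWeakIndependenceCalculus {L : FirstOrder.Language.{v, w}} (K : StrongClass.{u} L)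
    (κ : Cardinal.{u}) (M : Type u) [L.Structure M] (ind : TernaryRel L M) : Prop where
  invariance : ∀ (n : ℕ) (a : Fin n → M) (A₀ A₁ : L.Substructure M) (f : M ≃[L] M),
    K.Small κ A₀ → K.Small κ A₁ → K.StrongIn A₀ A₁ →
    ind a A₀ A₁ → ind (fun i => f (a i)) (A₀.map f.toHom) (A₁.map f.toHom)
  disjointness : ∀ (n : ℕ) (a : Fin n → M) (A₀ A₁ : L.Substructure M),
    K.Small κ A₀ → K.Small κ A₁ → K.StrongIn A₀ A₁ →
    ind a A₀ A₁ → ((∀ i, a i ∈ A₁) ↔ ∀ i, a i ∈ A₀)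
  symmetry : ∀ (m n : ℕ) (a : Fin m → M) (b : Fin n → M) (A₀ A₁ : L.Substructure M),
    K.Small κ A₀ → K.Small κ A₁ → K.StrongIn A₀ A₁ →
    ind b A₀ A₁ → (∀ i, a i ∈ A₁) →
    ∃ A₂ : L.Substructure M, K.Small κ A₂ ∧ K.StrongIn A₀ A₂ ∧ (∀ i, b i ∈ A₂) ∧ ind a A₀ A₂
  monotonicity : ∀ (n : ℕ) (a : Fin n → M) (A A' B' B : L.Substructure M),
    K.Small κ A → K.Small κ A' → K.Small κ B' → K.Small κ B →
    K.StrongIn A A' → K.StrongIn A' B' → K.StrongIn B' B →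
    ind a A B → ind a A' B'
  existence : ∀ (n : ℕ) (a : Fin n → M) (A B : L.Substructure M),
    K.Small κ A → K.Small κ B → K.StrongIn A B →
    ∃ b : Fin n → M, SameGaloisType A a b ∧ ind b A B
  uniqueness : ∀ (n : ℕ) (a b : Fin n → M) (A B : L.Substructure M),
    K.Small κ A → K.Small κ B → K.StrongIn A B →
    ind a A B → ind b A B → SameGaloisType A a b → SameGaloisType B a b
  continuity : ∀ (n : ℕ) (δ : Ordinal.{u}) (A : Ordinal.{u} → L.Substructure M)
    (a : Fin n → M) (a' : Ordinal.{u} → Fin n → M),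
    Order.IsSuccLimit δ → K.IsContinuousChain δ A →
    (A δ : Set M) = ⋃ i < δ, (A i : Set M) → K.Small κ (A δ) →
    (∀ i < δ, ind (a' i) (A 0) (A i) ∧ SameGaloisType (A i) (a' i) a) →
    ind a (A 0) (A δ)

/-- Superstable local character, the condition that makes a weak independence calculus a
superstable one. -/
def SuperstableLocalCharacter {L : FirstOrder.Language.{v, w}} (K : StrongClass.{u} L)
    (κ : Cardinal.{u}) (M : Type u) [L.Structure M] (ind : TernaryRel L M) : Prop :=
  ∀ (n : ℕ) (δ : Ordinal.{u}) (A : Ordinal.{u} → L.Substructure M) (a : Fin n → M),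
    Order.IsSuccLimit δ → K.IsContinuousChain δ A →
    (A δ : Set M) = ⋃ i < δ, (A i : Set M) → K.Small κ (A δ) →
    ∃ α < δ, ind a (A α) (A δ)

/-- `B` is independent from `C` over `A`: so is every finite tuple of elements of `B`. -/
def IndStructure {L : FirstOrder.Language.{v, w}} {M : Type u} [L.Structure M] (ind : TernaryRel L M)
    (B A C : L.Substructure M) : Prop :=
  ∀ (n : ℕ) (b : Fin n → M), (∀ i, b i ∈ B) → ind b A C

/-- Free independence: `⟨B, C⟩` is the free amalgam `B *_A C` and a strong submodel of `M`. -/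
def FreeInd {L : FirstOrder.Language.{v, w}} (V : AlgVariety L) (K : StrongClass.{u} L)
    {M : Type u} [L.Structure M] (B A C : L.Substructure M) : Prop :=
  V.IsFreeAmalgam A B C (B ⊔ C) ∧ K.strong M (B ⊔ C)

/-- The calculus `(K, ≼, ind)` in the monster model `M` is nice with respect to free factors. -/
structure IsNiceFreeFactors {L : FirstOrder.Language.{v, w}} (V : AlgVariety L) (K : StrongClass.{u} L)
    (κ : Cardinal.{u}) (M : Type u) [L.Structure M] (ind : TernaryRel L M) : Prop where
  star1 : ∃ n : ℕ, ∀ m : ℕ, n ≤ m →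
    ∀ (F : Type u) [L.Structure F], V.IsFreeOfRank F m → K.mem F
  star2 : ∃ m : ℕ, ∀ A B C : L.Substructure M,
    K.Small κ A → K.Small κ B → K.Small κ C →
    V.FreeFactor A B → V.FreeFactor A C → V.IsFreeOfRankGE A m →
    (IndStructure ind B A C ↔ FreeInd V K B A C)
  star3 : ∀ A B C : L.Substructure M,
    K.Small κ A → K.Small κ B → K.Small κ C →
    V.IsFreeFin A → V.IsFree B → V.IsFree C → K.StrongIn A B → V.FreeFactor A C →
    ∀ c ∈ C, ind ![c] A B →
      ∃ D : L.Substructure M, V.IsFreeFin D ∧ c ∈ D ∧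
        V.FreeFactor A D ∧ V.FreeFactor D C ∧ IndStructure ind D A B
  star4 : ∀ A B C D : L.Substructure M,
    K.Small κ A → K.Small κ B → K.Small κ C → K.Small κ D →
    V.IsFreeFin A → V.IsFreeFin B → V.IsFreeFin C → V.IsFree D →
    V.FreeFactor A B → V.FreeFactor B D → V.FreeFactor A C → V.FreeFactor C D →
    IndStructure ind B A C →
      V.IsFreeAmalgam A B C (B ⊔ C) ∧ V.FreeFactor (B ⊔ C) D

/-! Local character forces `A` to be a free factor of `B` itself. Taking the complementary algebra
`C` of rank 0, so that `B * C = B`, this contradicts the Construction Principle. Since `B` is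
countable, it may be placed strongly inside the monster model.

A free factor with free complement is generated by part of a basis (`freeFactor_iff`), so it
suffices to build a basis of `B` containing every `a i`. The approximations are finite sets `Y`
which, together with any sufficiently long initial segment of the `a i`, form part of a basis of `B`
(`IsStage`).

The heart is absorbing a given `b ∈ B` into such a `Y` (`IsStage.exists_extension`). Let `U` be
generated by `Y` and all the `a i`. It is the union of an ω-chain of finite rank free factors of
`B`, so `b` is independent from `U` over one link `E`. By `star3`, `b` lies in a finite rank free
factor `D` of `B`, with `E` a free factor of `D` and `D` independent from `U` over `E`. By `star4`,
the free amalgam over `E` of `D` with any later link is again a free factor of `B`. Hence adding to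
`Y` the finitely many elements that complete the basis of `E` to one of `D` gives a new stage, valid
for all later initial segments at once. Absorbing an enumeration of `B` and taking the union yields
the basis (`freeFactor_of_forall_initial_segment`). -/

open FirstOrder.Language FirstOrder.Language.Substructure

/-! ### Independent sets in a variety, inside an ambient structure -/

namespace AlgVariety

variable {L : FirstOrder.Language.{v, w}} (V : AlgVariety L)

/-- The set `X` is independent with respect to `V`: every equation between elements of `X` holds
under all assignments of `X` in algebras of `V`. -/
def IsIndep {M : Type u} [L.Structure M] (X : Set M) : Prop :=
  ∀ (N : Type u) [L.Structure N], V.Mem N → ∀ (f : X → N) (s t : L.Term X),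
    s.realize ((↑) : X → M) = t.realize ((↑) : X → M) → s.realize f = t.realize f

variable {V} {M N : Type u} [L.Structure M] [L.Structure N]

theorem mem_substructure_iff {S : L.Substructure M} :
    V.Mem S ↔ ∀ e ∈ V.identities, ∀ x : ℕ → M, (∀ n, x n ∈ S) → e.1.realize x = e.2.realize x := by
  refine ⟨fun h e he x hx => ?_, fun h e he x => Subtype.ext ?_⟩
  · have := congrArg S.subtype (h e he fun n => ⟨x n, hx n⟩)
    rw [← HomClass.realize_term S.subtype, ← HomClass.realize_term S.subtype] at this
    exact this
  · have := h e he (fun n => x n) fun n => (x n).2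
    exact (HomClass.realize_term S.subtype).symm.trans (this.trans (HomClass.realize_term S.subtype))

theorem mem_of_le {S T : L.Substructure M} (h : S ≤ T) (hT : V.Mem T) : V.Mem S :=
  mem_substructure_iff.2 fun e he x hx => mem_substructure_iff.1 hT e he x fun n => h (hx n)

theorem mem_map_iff (f : M ↪[L] N) {S : L.Substructure M} :
    V.Mem (S.map f.toHom) ↔ V.Mem S := by
  simp only [mem_substructure_iff]
  refine ⟨fun h e he x hx => f.injective ?_, fun h e he x hx => ?_⟩
  · rw [← HomClass.realize_term f, ← HomClass.realize_term f]
    exact h e he _ fun n => ⟨x n, hx n, rfl⟩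
  · choose y hy hyx using hx
    obtain rfl : f ∘ y = x := funext hyx
    rw [HomClass.realize_term f, HomClass.realize_term f, h e he y hy]

/-- Write each element of the closure as a term in `X` and evaluate that term at `f`. Independence
makes the value the same for every choice of term, which gives compatibility with the operations. -/
theorem IsIndep.exists_hom [L.IsAlgebraic] {X : Set M} (hX : V.IsIndep X) (hN : V.Mem N)
    (f : X → N) : ∃ h : closure L X →[L] N, ∀ x : X, h ⟨x, subset_closure x.2⟩ = f x := by
  have key : ∀ x : closure L X, ∃ t : L.Term X, t.realize ((↑) : X → M) = x := fun x =>
    mem_closure_iff_exists_term.1 x.2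
  choose T hT using key
  refine ⟨⟨fun x => (T x).realize f, fun {n} F x => ?_, fun {n} r => isEmptyElim r⟩, fun x => ?_⟩
  · refine hX N hN f _ (Term.func F fun i => T (x i)) ?_
    rw [hT, Term.realize_func]
    simp only [hT]
    rfl
  · exact hX N hN f _ (Term.var x) (by rw [hT]; rfl)

theorem isIndep_of_exists_hom {X : Set M} {S : L.Substructure M} (hXS : X ⊆ S)
    (h : ∀ (N : Type u) [L.Structure N], V.Mem N → ∀ f : X → N,
      ∃ h : S →[L] N, ∀ x : X, h ⟨x, hXS x.2⟩ = f x) : V.IsIndep X := by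
  intro N _ hN f s t hst
  obtain ⟨g, hg⟩ := h N hN f
  obtain rfl : g ∘ (fun x : X => (⟨x, hXS x.2⟩ : S)) = f := funext hg
  rw [HomClass.realize_term g, HomClass.realize_term g]
  congr 1
  apply S.subtype.injective
  rw [← HomClass.realize_term S.subtype, ← HomClass.realize_term S.subtype]
  exact hst

theorem IsIndep.mono {X Y : Set M} (hY : V.IsIndep Y) (h : X ⊆ Y) : V.IsIndep X := by
  classical
  intro N _ hN f s t hst
  -- A default value in `N` is needed to extend `f` from `X` to `Y`; the term `s` supplies one.
  have : Nonempty N := ⟨s.realize f⟩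
  obtain ⟨g, hg⟩ : ∃ g : Y → N, g ∘ Set.inclusion h = f :=
    ⟨_, Function.Injective.factorsThrough (Set.inclusion_injective h) f |>.extend_comp
      (e' := fun _ => Classical.arbitrary N)⟩
  have := hY N hN g (s.relabel (Set.inclusion h)) (t.relabel (Set.inclusion h))
  simp only [Term.realize_relabel, hg] at this
  exact this hst

/-- An equation between two terms involves only finitely many variables. -/
theorem isIndep_of_finite {X : Set M}
    (h : ∀ Y ⊆ X, Y.Finite → ∃ Z ⊆ X, Y ⊆ Z ∧ V.IsIndep Z) : V.IsIndep X := by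
  classical
  intro N _ hN f s t hst
  obtain ⟨Z, hZX, hZ, hi⟩ := h ((↑) '' ((s.varFinset ∪ t.varFinset : Finset X) : Set X))
    (by rintro _ ⟨x, -, rfl⟩; exact x.2) ((Finset.finite_toSet _).image _)
  have hs : ∀ x : s.varFinset, (x : M) ∈ Z := fun x => hZ ⟨x, by simp, rfl⟩
  have ht : ∀ x : t.varFinset, (x : M) ∈ Z := fun x => hZ ⟨x, by simp, rfl⟩
  have := hi N hN (f ∘ Set.inclusion hZX) (s.restrictVar fun x => ⟨x, hs x⟩)
    (t.restrictVar fun x => ⟨x, ht x⟩)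
  rw [Term.realize_restrictVar (f := fun x : s.varFinset => (⟨x, hs x⟩ : Z)) f (fun _ => rfl),
    Term.realize_restrictVar (f := fun x : t.varFinset => (⟨x, ht x⟩ : Z)) f (fun _ => rfl),
    Term.realize_restrictVar (f := fun x : s.varFinset => (⟨x, hs x⟩ : Z)) (fun x : X => (x : M))
      (fun _ => rfl),
    Term.realize_restrictVar (f := fun x : t.varFinset => (⟨x, ht x⟩ : Z)) (fun x : X => (x : M))
      (fun _ => rfl)] at this
  exact this hst

theorem isIndep_iUnion {X : ℕ → Set M} (hX : Monotone X) (h : ∀ n, V.IsIndep (X n)) :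
    V.IsIndep (⋃ n, X n) := by
  refine isIndep_of_finite fun Y hY hfin => ?_
  obtain ⟨Y, rfl⟩ := hfin.exists_finset_coe
  obtain ⟨n, hn⟩ := hX.directed_le.exists_mem_subset_of_finset_subset_biUnion hY
  exact ⟨X n, Set.subset_iUnion X n, hn, h n⟩

theorem isIndep_image_iff (f : M ↪[L] N) {X : Set M} : V.IsIndep (f '' X) ↔ V.IsIndep X := by
  let e : X ≃ f '' X := Equiv.Set.image f X f.injective
  have he : ((↑) : f '' X → N) ∘ e = f ∘ ((↑) : X → M) := rfl
  have he' : f ∘ ((↑) : X → M) ∘ e.symm = ((↑) : f '' X → N) := by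
    rw [← Function.comp_assoc, ← he, Function.comp_assoc, e.self_comp_symm, Function.comp_id]
  refine ⟨fun h P _ hP g s t hst => ?_, fun h P _ hP g s t hst => ?_⟩
  · have := h P hP (g ∘ e.symm) (s.relabel e) (t.relabel e)
    simp only [Term.realize_relabel, Function.comp_assoc, e.symm_comp_self, Function.comp_id, he,
      HomClass.realize_term f] at this
    exact this (by rw [hst])
  · have := h P hP (g ∘ e) (s.relabel e.symm) (t.relabel e.symm)
    simp only [Term.realize_relabel, Function.comp_assoc, e.self_comp_symm,
      Function.comp_id] at this
    refine this (f.injective ?_)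
    rwa [← HomClass.realize_term f, ← HomClass.realize_term f, he']

theorem closure_coe_image {S : L.Substructure M} (Y : Set S) (hY : closure L Y = ⊤) :
    closure L (((↑) : S → M) '' Y) = S := by
  have := Substructure.map_closure S.subtype.toHom Y
  rw [hY] at this
  refine (this.symm.trans ?_)
  ext x
  simp [Substructure.mem_map]

theorem IsBasis.isIndep {S : L.Substructure M} {Y : Set S} (h : V.IsBasis S Y) :
    V.IsIndep (((↑) : S → M) '' Y) := by
  refine (isIndep_image_iff S.subtype).2 ?_
  refine isIndep_of_exists_hom (S := ⊤) (fun x _ => Substructure.mem_top x) fun N _ hN f => ?_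
  obtain ⟨g, hg⟩ := h.2.2 N hN f
  exact ⟨g.comp (⊤ : L.Substructure S).subtype.toHom, hg⟩

theorem closure_coe_preimage (X : Set M) :
    closure L (((↑) : closure L X → M) ⁻¹' X) = ⊤ := by
  refine Substructure.map_injective_of_injective (f := (closure L X).subtype.toHom)
    Subtype.val_injective ?_
  rw [Substructure.map_closure]
  have : (closure L X).subtype.toHom '' (((↑) : closure L X → M) ⁻¹' X) = X :=
    Set.image_preimage_eq_of_subset (f := ((↑) : closure L X → M))
      fun x hx => ⟨⟨x, subset_closure hx⟩, rfl⟩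
  rw [this]
  ext x
  simp [Substructure.mem_map]

theorem hom_closure_ext {X : Set M} {f g : closure L X →[L] N}
    (h : ∀ x (hx : x ∈ X), f ⟨x, subset_closure hx⟩ = g ⟨x, subset_closure hx⟩) : f = g :=
  Language.Hom.eq_of_eqOn_dense (closure_coe_preimage X) fun x hx => h x hx

theorem IsIndep.isBasis [L.IsAlgebraic] {S : L.Substructure M} {X : Set M} (hX : V.IsIndep X)
    (hS : V.Mem S) (h : closure L X = S) : V.IsBasis S (((↑) : S → M) ⁻¹' X) := by
  subst h
  refine ⟨hS, ?_, fun N _ hN f => ?_⟩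
  · exact closure_coe_preimage X
  · obtain ⟨g, hg⟩ := hX.exists_hom hN fun x => f ⟨⟨x, subset_closure x.2⟩, x.2⟩
    exact ⟨g, fun x => hg ⟨x, x.2⟩⟩

/-! ### Free factors and free amalgams in terms of bases -/

theorem isFree_iff [L.IsAlgebraic] {S : L.Substructure M} :
    V.IsFree S ↔ V.Mem S ∧ ∃ X, V.IsIndep X ∧ closure L X = S :=
  ⟨fun ⟨_, hY⟩ => ⟨hY.1, _, hY.isIndep, closure_coe_image _ hY.2.1⟩,
    fun ⟨hS, _, hX, h⟩ => ⟨_, hX.isBasis hS h⟩⟩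

theorem isFreeFin_closure [L.IsAlgebraic] {X : Set M} (hX : V.IsIndep X)
    (h : V.Mem (closure L X)) (hfin : X.Finite) : V.IsFreeFin (closure L X) :=
  ⟨_, hX.isBasis h rfl, hfin.preimage Subtype.val_injective.injOn⟩

theorem isFreeOfRank_closure [L.IsAlgebraic] {X : Set M} (hX : V.IsIndep X)
    (h : V.Mem (closure L X)) (hfin : X.Finite) : V.IsFreeOfRank (closure L X) X.ncard := by
  refine ⟨_, hX.isBasis h rfl, ?_⟩
  rw [hfin.cast_ncard_eq]
  exact Set.encard_preimage_of_injective_subset_range Subtype.val_injective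
    fun x hx => ⟨⟨x, subset_closure hx⟩, rfl⟩

/-- The added set is any basis of a free complement: an assignment on the union is handled
separately on the two factors and glued by the coproduct property. Starting from an arbitrary basis
of `A` is what later keeps the elements already chosen. -/
theorem FreeFactor.exists_basis [L.IsAlgebraic] {A B : L.Substructure M} (h : V.FreeFactor A B)
    {X : Set M} (hX : V.IsIndep X) (hXA : closure L X = A) :
    ∃ Y, V.IsIndep (X ∪ Y) ∧ closure L (X ∪ Y) = B := by
  obtain ⟨-, -, C, hC, hB, hsup, hP⟩ := h
  obtain ⟨-, Y, hY, rfl⟩ := isFree_iff.1 hC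
  subst hXA
  have hcl : closure L (X ∪ Y) = B := by rw [Substructure.closure_union, hsup]
  have hXY : X ∪ Y ⊆ B := hcl ▸ subset_closure
  refine ⟨Y, isIndep_of_exists_hom hXY fun N _ hN f => ?_, hcl⟩
  obtain ⟨g₁, hg₁⟩ := hX.exists_hom hN fun x => f ⟨x, Or.inl x.2⟩
  obtain ⟨g₂, hg₂⟩ := hY.exists_hom hN fun x => f ⟨x, Or.inr x.2⟩
  obtain ⟨g, h₁, h₂⟩ := hP N hN g₁ g₂
  refine ⟨g, fun ⟨x, hx⟩ => ?_⟩
  obtain hx' | hx' := hx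
  · exact (h₁ x (subset_closure hx') _).trans (hg₁ ⟨x, hx'⟩)
  · exact (h₂ x (subset_closure hx') _).trans (hg₂ ⟨x, hx'⟩)

theorem IsIndep.isFreeProduct [L.IsAlgebraic] {X Y : Set M} (hXY : V.IsIndep (X ∪ Y))
    (hd : Disjoint X Y) (hB : V.Mem (closure L (X ∪ Y))) :
    V.IsFreeProduct (closure L X) (closure L Y) (closure L (X ∪ Y)) := by
  classical
  refine ⟨hB, (Substructure.closure_union _ _).symm, fun N _ hN f g => ?_⟩
  obtain ⟨h, hh⟩ := hXY.exists_hom hN fun x => if hx : (x : M) ∈ X then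
    f ⟨x, subset_closure hx⟩ else g ⟨x, subset_closure (x.2.resolve_left hx)⟩
  have hXl : closure L X ≤ closure L (X ∪ Y) := closure_mono Set.subset_union_left
  have hYl : closure L Y ≤ closure L (X ∪ Y) := closure_mono Set.subset_union_right
  have h₁ : h.comp (Substructure.inclusion hXl).toHom = f :=
    hom_closure_ext fun x hx => (hh ⟨x, Or.inl hx⟩).trans (dif_pos hx)
  have h₂ : h.comp (Substructure.inclusion hYl).toHom = g :=
    hom_closure_ext fun x hx => (hh ⟨x, Or.inr hx⟩).trans
      (dif_neg (Set.disjoint_right.1 hd hx))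
  exact ⟨h, fun x hx _ => DFunLike.congr_fun h₁ ⟨x, hx⟩, fun x hx _ => DFunLike.congr_fun h₂ ⟨x, hx⟩⟩

theorem IsIndep.freeFactor [L.IsAlgebraic] {X Y : Set M} (hY : V.IsIndep Y) (hXY : X ⊆ Y)
    (hB : V.Mem (closure L Y)) : V.FreeFactor (closure L X) (closure L Y) := by
  have hle : closure L X ≤ closure L Y := closure_mono hXY
  have hle' : closure L (Y \ X) ≤ closure L Y := closure_mono Set.sdiff_subset
  refine ⟨isFree_iff.2 ⟨mem_of_le hle hB, X, hY.mono hXY, rfl⟩, isFree_iff.2 ⟨hB, Y, hY, rfl⟩,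
    closure L (Y \ X), isFree_iff.2 ⟨mem_of_le hle' hB, _, hY.mono Set.sdiff_subset, rfl⟩, ?_⟩
  have hu : X ∪ Y \ X = Y := Set.union_sdiff_cancel hXY
  have := IsIndep.isFreeProduct (V := V) (X := X) (Y := Y \ X) (by rwa [hu])
    Set.disjoint_sdiff_right (by rwa [hu])
  rwa [hu] at this

/-- Replaces the coproduct property by set-theoretic data that can be moved along embeddings and
passed to unions. -/
theorem freeFactor_iff [L.IsAlgebraic] {A B : L.Substructure M} :
    V.FreeFactor A B ↔
      V.Mem B ∧ ∃ X Y, X ⊆ Y ∧ V.IsIndep Y ∧ Substructure.closure L X = A ∧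
        Substructure.closure L Y = B := by
  refine ⟨fun h => ?_, ?_⟩
  · obtain ⟨-, X, hX, hXA⟩ := isFree_iff.1 h.1
    obtain ⟨Y, hY, hYB⟩ := h.exists_basis hX hXA
    exact ⟨(isFree_iff.1 h.2.1).1, X, X ∪ Y, Set.subset_union_left, hY, hXA, hYB⟩
  · rintro ⟨hB, X, Y, hXY, hY, rfl, rfl⟩
    exact hY.freeFactor hXY hB

theorem FreeFactor.le {A B : L.Substructure M} (h : V.FreeFactor A B) : A ≤ B := by
  obtain ⟨-, -, C, -, -, h, -⟩ := h
  exact h ▸ le_sup_left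

theorem FreeFactor.map [L.IsAlgebraic] (f : M ↪[L] N) {A B : L.Substructure M}
    (h : V.FreeFactor A B) : V.FreeFactor (A.map f.toHom) (B.map f.toHom) := by
  obtain ⟨hB, X, Y, hXY, hY, rfl, rfl⟩ := freeFactor_iff.1 h
  refine freeFactor_iff.2 ⟨(mem_map_iff f).2 hB, f '' X, f '' Y, Set.image_mono hXY,
    (isIndep_image_iff f).2 hY, (Substructure.map_closure f.toHom X).symm,
    (Substructure.map_closure f.toHom Y).symm⟩

/-- A finitely generated free algebra with a free factor `⟨X⟩` has a basis extending `X` by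
finitely many elements. -/
theorem FreeFactor.exists_finite_basis [L.IsAlgebraic] {A B : L.Substructure M}
    (h : V.FreeFactor A B) (hB : V.IsFreeFin B) {X : Set M} (hX : V.IsIndep X)
    (hXA : closure L X = A) :
    ∃ Y, Y.Finite ∧ V.IsIndep (X ∪ Y) ∧ closure L (X ∪ Y) = B := by
  obtain ⟨Y, hY, hYB⟩ := h.exists_basis hX hXA
  obtain ⟨W, hW, hWfin⟩ := hB
  have hcl := closure_coe_image W hW.2.1
  have hWfin' : (((↑) : B → M) '' W).Finite := hWfin.image _
  -- Each of the finitely many generators in `W` uses only finitely many elements of `Y`; the union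
  -- of these finite supports already generates `B` over `X`.
  have key : ∀ w ∈ ((↑) : B → M) '' W, ∃ Z ⊆ Y, Z.Finite ∧ w ∈ closure L (X ∪ Z) := by
    rintro _ ⟨w, -, rfl⟩
    have hw : (w : M) ∈ closure L (X ∪ Y) := hYB ▸ w.2
    clear hcl hW hWfin hWfin' W
    generalize (w : M) = x at hw
    refine Substructure.closure_induction hw ?_ ?_
    · intro n F x hx
      replace hx : ∀ i, ∃ Z ⊆ Y, Z.Finite ∧ x i ∈ closure L (X ∪ Z) := hx
      choose Z hZY hZ hxZ using hx
      refine ⟨⋃ i, Z i, Set.iUnion_subset hZY, Set.finite_iUnion hZ, ?_⟩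
      exact (Substructure.closure L _).fun_mem F x fun i =>
        closure_mono (Set.union_subset_union_right _ (Set.subset_iUnion Z i)) (hxZ i)
    · intro x hx
      obtain hx | hx := hx
      · exact ⟨∅, Set.empty_subset _, Set.finite_empty, subset_closure (Or.inl hx)⟩
      · exact ⟨{x}, Set.singleton_subset_iff.2 hx, Set.finite_singleton x,
          subset_closure (Or.inr rfl)⟩
  choose! Z hZY hZ hwZ using key
  have hsub : (⋃ w ∈ ((↑) : B → M) '' W, Z w) ⊆ Y := Set.iUnion₂_subset hZY
  refine ⟨⋃ w ∈ ((↑) : B → M) '' W, Z w, hWfin'.biUnion hZ,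
    hY.mono (Set.union_subset_union_right _ hsub), le_antisymm ?_ ?_⟩
  · exact (closure_mono (Set.union_subset_union_right _ hsub)).trans hYB.le
  · refine hcl.ge.trans (closure_le.2 ?_)
    exact fun w hw => closure_mono (Set.union_subset_union_right _
      (Set.subset_biUnion_of_mem (u := Z) hw)) (hwZ w hw)

/-- An assignment on `Y ∪ Z` induces homomorphisms on the two sides that agree on the generators `X`
of the common part, so the pushout property glues them. -/
theorem IsFreeAmalgam.isIndep_union [L.IsAlgebraic] {X Y Z : Set M} (hY : V.IsIndep Y)
    (hZ : V.IsIndep Z) (hXY : X ⊆ Y) (hXZ : X ⊆ Z) {P : L.Substructure M}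
    (h : V.IsFreeAmalgam (closure L X) (closure L Y) (closure L Z) P) : V.IsIndep (Y ∪ Z) := by
  obtain ⟨-, -, -, rfl, h⟩ := h
  have hsub : Y ∪ Z ⊆ (closure L Y ⊔ closure L Z : L.Substructure M) := by
    rw [← Substructure.closure_union]
    exact subset_closure
  refine isIndep_of_exists_hom hsub fun N _ hN f => ?_
  obtain ⟨g₁, hg₁⟩ := hY.exists_hom hN fun x => f ⟨x, Or.inl x.2⟩
  obtain ⟨g₂, hg₂⟩ := hZ.exists_hom hN fun x => f ⟨x, Or.inr x.2⟩
  have hg : g₁.comp (Substructure.inclusion (closure_mono hXY)).toHom =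
      g₂.comp (Substructure.inclusion (closure_mono hXZ)).toHom :=
    hom_closure_ext fun x hx => (hg₁ ⟨x, hXY hx⟩).trans (hg₂ ⟨x, hXZ hx⟩).symm
  obtain ⟨g, h₁, h₂⟩ := h N hN g₁ g₂ fun x _ _ hx => DFunLike.congr_fun hg ⟨x, hx⟩
  refine ⟨g, fun ⟨x, hx⟩ => ?_⟩
  obtain hx' | hx' := hx
  · exact (h₁ x (subset_closure hx') _).trans (hg₁ ⟨x, hx'⟩)
  · exact (h₂ x (subset_closure hx') _).trans (hg₂ ⟨x, hx'⟩)

end AlgVariety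

/-! ### Chains of length ω as ordinal-indexed chains -/

section Chains

variable {L : FirstOrder.Language.{v, w}} {M : Type u} [L.Structure M]

open Classical in
/-- The sequence `E`, extended by `U` to all ordinals. -/
noncomputable def natChain (E : ℕ → L.Substructure M) (U : L.Substructure M)
    (α : Ordinal.{u}) : L.Substructure M :=
  if h : α < Ordinal.omega0 then E (Ordinal.lt_omega0.1 h).choose else U

variable {E : ℕ → L.Substructure M} {U : L.Substructure M}

theorem natChain_natCast (n : ℕ) : natChain E U (n : Ordinal.{u}) = E n := by
  have h := Ordinal.natCast_lt_omega0.{u} n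
  rw [natChain, dif_pos h, ← Nat.cast_injective (R := Ordinal.{u}) (Ordinal.lt_omega0.1 h).choose_spec]

theorem natChain_omega0 : natChain E U Ordinal.omega0.{u} = U :=
  dif_neg (lt_irrefl _)

theorem iUnion_natChain :
    ⋃ i < Ordinal.omega0.{u}, (natChain E U i : Set M) = ⋃ n, (E n : Set M) := by
  ext x
  simp only [Set.mem_iUnion, exists_prop]
  constructor
  · rintro ⟨i, hi, hx⟩
    obtain ⟨n, rfl⟩ := Ordinal.lt_omega0.1 hi
    rw [natChain_natCast] at hx
    exact ⟨n, hx⟩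
  · rintro ⟨n, hx⟩
    exact ⟨n, Ordinal.natCast_lt_omega0 n, by rwa [natChain_natCast]⟩

namespace StrongClass

variable {K : StrongClass.{u} L}

theorem IsAEC.isContinuousChain_natChain (hK : K.IsAEC) (hE : Monotone E)
    (hs : ∀ n, K.strong M (E n)) :
    K.IsContinuousChain Ordinal.omega0.{u} (natChain E U) where
  mem i hi := by
    obtain ⟨n, rfl⟩ := Ordinal.lt_omega0.1 hi
    rw [natChain_natCast]
    exact (hK.mem_of_strong M _ (hs n)).2
  strongIn i j hij hj := by
    obtain ⟨n, rfl⟩ := Ordinal.lt_omega0.1 hj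
    obtain ⟨m, rfl⟩ := Ordinal.lt_omega0.1 (hij.trans_lt hj)
    rw [natChain_natCast, natChain_natCast]
    exact hK.coherence M _ _ (hs m) (hs n) (hE (Nat.cast_le.1 hij))
  continuous j hj hlim := by
    obtain ⟨n, rfl⟩ := Ordinal.lt_omega0.1 hj
    -- Continuity is vacuous: there is no limit ordinal below ω.
    exact absurd (Ordinal.omega0_le_of_isSuccLimit hlim) (not_le.2 hj)

theorem IsAEC.strong_iUnion (hK : K.IsAEC) (hE : Monotone E) (hs : ∀ n, K.strong M (E n))
    (hU : (U : Set M) = ⋃ n, (E n : Set M)) : K.strong M U := by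
  refine (hK.union M Ordinal.omega0 (natChain E U) U Ordinal.isSuccLimit_omega0
    (hK.isContinuousChain_natChain hE hs) (by rw [iUnion_natChain, hU])).2.2 fun i hi => ?_
  obtain ⟨n, rfl⟩ := Ordinal.lt_omega0.1 hi
  rw [natChain_natCast]
  exact hs n

end StrongClass

theorem SuperstableLocalCharacter.exists_nat {K : StrongClass.{u} L} {κ : Cardinal.{u}}
    {ind : TernaryRel L M} (h : SuperstableLocalCharacter K κ M ind) (hK : K.IsAEC)
    (hE : Monotone E) (hs : ∀ n, K.strong M (E n)) (hU : (U : Set M) = ⋃ n, (E n : Set M))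
    (hUs : K.Small κ U) {n : ℕ} (a : Fin n → M) : ∃ m, ind a (E m) U := by
  obtain ⟨α, hα, ha⟩ := h n Ordinal.omega0 (natChain E U) a Ordinal.isSuccLimit_omega0
    (hK.isContinuousChain_natChain hE hs) (by rw [iUnion_natChain, natChain_omega0, hU])
    (by rwa [natChain_omega0])
  obtain ⟨m, rfl⟩ := Ordinal.lt_omega0.1 hα
  rw [natChain_natCast, natChain_omega0] at ha
  exact ⟨m, ha⟩

theorem coe_closure_iUnion {X : ℕ → Set M} (hX : Monotone X) :
    (closure L (⋃ n, X n) : Set M) = ⋃ n, (closure L (X n) : Set M) := by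
  ext x
  rw [SetLike.mem_coe, Substructure.closure_iUnion, mem_iSup_of_directed
    (Monotone.directed_le fun _ _ h => closure_mono (hX h))]
  simp

end Chains

/-! ### Building a basis of `B` in stages -/

namespace AlgVariety

variable {L : FirstOrder.Language.{v, w}} (V : AlgVariety L) {M : Type u} [L.Structure M]

/-- The elements `a 0, …, a j` together with the finite set `Y` form a basis of a free factor of
`B`, for all `j ≥ i`. -/
def IsStage (B : L.Substructure M) (a : ℕ → M) (i : ℕ) (Y : Set M) : Prop :=
  Y.Finite ∧ ∀ j, i ≤ j → V.IsIndep (a '' Set.Iic j ∪ Y) ∧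
    V.FreeFactor (Substructure.closure L (a '' Set.Iic j ∪ Y)) B

variable {V} {K : StrongClass.{u} L} {κ : Cardinal.{u}} {ind : TernaryRel L M}
  {B : L.Substructure M}

theorem le_ncard_image_Iic_union {a : ℕ → M} (ha : Function.Injective a) {n j : ℕ} (h : n ≤ j)
    {Y : Set M} (hY : Y.Finite) : n ≤ (a '' Set.Iic j ∪ Y).ncard := by
  calc n ≤ (a '' Set.Iic j).ncard := by
        rw [Set.ncard_image_of_injective _ ha, ← Finset.coe_Iic, Set.ncard_coe_finset,
          Nat.card_Iic]
        omega
    _ ≤ _ := Set.ncard_le_ncard Set.subset_union_left (((Set.finite_Iic j).image a).union hY)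

/-- Once the rank is at least the bound of `star1`, the factor lies in `K`, and the covering turns
the free factor relation into a strong one. Transitivity through `B` does the rest. -/
theorem small_closure_of_freeFactor [L.IsAlgebraic] (hK : K.IsAECCovering V)
    {n : ℕ} (hn : ∀ m : ℕ, n ≤ m →
      ∀ (F : Type u) [L.Structure F], V.IsFreeOfRank F m → K.mem F)
    (hB : K.Small κ B) {X : Set M} (hX : V.IsIndep X) (hXfin : X.Finite) (hXn : n ≤ X.ncard)
    (hXB : V.FreeFactor (closure L X) B) : K.Small κ (closure L X) := by
  have hmem := mem_of_le hXB.le (isFree_iff.1 hXB.2.1).1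
  have hm : K.mem (closure L X) := hn _ hXn _ (isFreeOfRank_closure hX hmem hXfin)
  have hBm := (hK.isAEC.mem_of_strong M B hB.1).2
  exact ⟨hK.isAEC.trans M _ B (hK.strongIn_of_freeFactor M _ B hm hBm hXB) hB.1,
    (Cardinal.mk_le_mk_of_subset hXB.le).trans_lt hB.2⟩

/-- The inductive step, and the only place where local character acts. The bound `n ≤ i` keeps all
the finite rank factors involved inside `K`. -/
theorem IsStage.exists_extension [L.IsAlgebraic] (hK : K.IsAECCovering V)
    (hind : IsWeakIndependenceCalculus K κ M ind) (hnice : IsNiceFreeFactors V K κ M ind)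
    (hss : SuperstableLocalCharacter K κ M ind)
    {n : ℕ} (hn : ∀ m : ℕ, n ≤ m →
      ∀ (F : Type u) [L.Structure F], V.IsFreeOfRank F m → K.mem F)
    (hB : K.Small κ B) {a : ℕ → M} (ha : Function.Injective a) {i : ℕ} (hni : n ≤ i) {Y : Set M}
    (h : V.IsStage B a i Y) {b : M} (hb : b ∈ B) :
    ∃ i' Y', i ≤ i' ∧ Y ⊆ Y' ∧ V.IsStage B a i' Y' ∧
      b ∈ Substructure.closure L (a '' Set.Iic i' ∪ Y') := by
  obtain ⟨hY, h⟩ := h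
  have hBmem : V.Mem B := (isFree_iff.1 (h i le_rfl).2.2.1).1
  let X : ℕ → Set M := fun j => a '' Set.Iic (i + j) ∪ Y
  have hXmono : Monotone X := fun j k hjk =>
    Set.union_subset_union_left _ (Set.image_mono (Set.Iic_subset_Iic.2 (by omega)))
  have hXfin (j : ℕ) : (X j).Finite := ((Set.finite_Iic _).image a).union hY
  have hXi (j : ℕ) : V.IsIndep (X j) := (h (i + j) (by omega)).1
  have hXB (j : ℕ) : V.FreeFactor (closure L (X j)) B := (h (i + j) (by omega)).2
  have hXmem (j : ℕ) : V.Mem (closure L (X j)) := mem_of_le (hXB j).le hBmem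
  have hXs (j : ℕ) : K.Small κ (closure L (X j)) :=
    small_closure_of_freeFactor hK hn hB (hXi j) (hXfin j)
      (le_ncard_image_Iic_union ha (by omega) hY) (hXB j)
  have hUB : closure L (⋃ j, X j) ≤ B :=
    closure_le.2 (Set.iUnion_subset fun j => closure_le.1 (hXB j).le)
  have hUi : V.IsIndep (⋃ j, X j) := isIndep_iUnion hXmono hXi
  have hUs : K.Small κ (closure L (⋃ j, X j)) :=
    ⟨hK.isAEC.strong_iUnion (fun _ _ hjk => closure_mono (hXmono hjk)) (fun j => (hXs j).1)
      (coe_closure_iUnion hXmono), (Cardinal.mk_le_mk_of_subset hUB).trans_lt hB.2⟩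
  have hXU (j : ℕ) : K.StrongIn (closure L (X j)) (closure L (⋃ j, X j)) :=
    hK.isAEC.coherence M _ _ (hXs j).1 hUs.1 (closure_mono (Set.subset_iUnion X j))
  have hXX {j k : ℕ} (hjk : j ≤ k) : K.StrongIn (closure L (X j)) (closure L (X k)) :=
    hK.isAEC.coherence M _ _ (hXs j).1 (hXs k).1 (closure_mono (hXmono hjk))
  have hUfree : V.IsFree (closure L (⋃ j, X j)) :=
    isFree_iff.2 ⟨mem_of_le hUB hBmem, _, hUi, rfl⟩
  -- Independence is from the whole union, so this single `m` will serve for every later link.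
  obtain ⟨m, hm⟩ := hss.exists_nat hK.isAEC (fun _ _ hjk => closure_mono (hXmono hjk))
    (fun j => (hXs j).1) (coe_closure_iUnion hXmono) hUs ![b]
  obtain ⟨D, hD, hbD, hmD, hDB, hDind⟩ := hnice.star3 _ _ _ (hXs m) hUs hB
    (isFreeFin_closure (hXi m) (hXmem m) (hXfin m)) hUfree (hXB m).2.1 (hXU m) (hXB m) b hb hm
  obtain ⟨Z, hZfin, hZi, rfl⟩ := hmD.exists_finite_basis hD (hXi m) rfl
  have hDs : K.Small κ (closure L (X m ∪ Z)) :=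
    small_closure_of_freeFactor hK hn hB hZi ((hXfin m).union hZfin)
      ((le_ncard_image_Iic_union ha (by omega : n ≤ i + m) hY).trans
        (Set.ncard_le_ncard Set.subset_union_left ((hXfin m).union hZfin))) hDB
  -- The set required by the new stage is the union of the bases of `D` and of the link `X j`, which
  -- share `X m`.
  have hXZ (j : ℕ) (hj : m ≤ j) : a '' Set.Iic (i + j) ∪ (Y ∪ Z) = X m ∪ Z ∪ X j := by
    rw [Set.union_right_comm, Set.union_eq_self_of_subset_left (hXmono hj), Set.union_assoc]
  refine ⟨i + m, Y ∪ Z, by omega, Set.subset_union_left, ⟨hY.union hZfin, fun j hj => ?_⟩, ?_⟩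
  · obtain ⟨j, rfl⟩ := Nat.exists_eq_add_of_le (show i ≤ j by omega)
    have hmj : m ≤ j := by omega
    -- Monotonicity cuts the independence of `D` from the union down to the finite rank link `X j`,
    -- as `star4` demands.
    obtain ⟨h₁, h₂⟩ := hnice.star4 _ _ (closure L (X j)) _ (hXs m) hDs (hXs j) hB
      (isFreeFin_closure (hXi m) (hXmem m) (hXfin m)) hD
      (isFreeFin_closure (hXi j) (hXmem j) (hXfin j)) (hXB m).2.1 hmD hDB
      ((hXi j).freeFactor (hXmono hmj) (hXmem j)) (hXB j) fun k c hc =>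
        hind.monotonicity k c _ _ _ _ (hXs m) (hXs m) (hXs j) hUs (hXX le_rfl) (hXX hmj) (hXU j)
          (hDind k c hc)
    rw [hXZ j hmj]
    refine ⟨h₁.isIndep_union hZi (hXi j) Set.subset_union_left (hXmono hmj), ?_⟩
    rwa [Substructure.closure_union]
  · rw [hXZ m le_rfl, Set.union_right_comm, Set.union_self]
    exact hbD

/-- If superstable local character holds, then the independent elements `a 0, a 1, …` of
a countable free algebra, all of whose initial segments generate free factors, generate a free
factor. -/
theorem freeFactor_of_forall_initial_segment [L.IsAlgebraic] (hK : K.IsAECCovering V)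
    (hind : IsWeakIndependenceCalculus K κ M ind) (hnice : IsNiceFreeFactors V K κ M ind)
    (hss : SuperstableLocalCharacter K κ M ind) (hB : K.Small κ B) [Countable B]
    {a : ℕ → M} (ha : Function.Injective a)
    (h : ∀ i, V.IsIndep (a '' Set.Iic i) ∧
      V.FreeFactor (Substructure.closure L (a '' Set.Iic i)) B) :
    V.FreeFactor (Substructure.closure L (Set.range a)) B := by
  obtain ⟨n, hn⟩ := hnice.star1
  have haB (i : ℕ) : a i ∈ B := (h i).2.le (subset_closure ⟨i, Set.mem_Iic.2 le_rfl, rfl⟩)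
  have : Nonempty B := ⟨⟨a 0, haB 0⟩⟩
  have hBmem : V.Mem B := (isFree_iff.1 (h 0).2.2.1).1
  obtain ⟨e, he⟩ := exists_surjective_nat B
  let S := {p : ℕ × Set M // n ≤ p.1 ∧ V.IsStage B a p.1 p.2}
  have step : ∀ (p : S) (b : B), ∃ q : S, p.1.1 ≤ q.1.1 ∧ p.1.2 ⊆ q.1.2 ∧
      (b : M) ∈ Substructure.closure L (a '' Set.Iic q.1.1 ∪ q.1.2) := by
    rintro ⟨⟨i, Y⟩, hni, hY⟩ b
    obtain ⟨i', Y', hi, hYY, hs, hb⟩ := hY.exists_extension hK hind hnice hss hn hB ha hni b.2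
    exact ⟨⟨(i', Y'), hni.trans hi, hs⟩, hi, hYY, hb⟩
  choose next hnext₁ hnext₂ hnext₃ using step
  -- The empty set is a stage by the hypothesis on initial segments; starting at index `n` ensures
  -- ranks large enough for `star1`.
  let s : ℕ → S := fun k => Nat.rec
    ⟨(n, ∅), le_rfl, Set.finite_empty, fun j _ => by simpa using h j⟩ (fun k p => next p (e k)) k
  have hs (k : ℕ) : s (k + 1) = next (s k) (e k) := rfl
  have hs₁ : Monotone fun k => (s k).1.1 := monotone_nat_of_le_succ fun k => hnext₁ (s k) (e k)
  have hs₂ : Monotone fun k => (s k).1.2 := monotone_nat_of_le_succ fun k => hnext₂ (s k) (e k)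
  -- The stage indices may stop growing; the summand `k` ensures that every `a k` is eventually
  -- included.
  let W : ℕ → Set M := fun k => a '' Set.Iic ((s k).1.1 + k) ∪ (s k).1.2
  have hW : Monotone W := fun j k hjk => Set.union_subset_union
    (Set.image_mono (Set.Iic_subset_Iic.2 (Nat.add_le_add (hs₁ hjk) hjk))) (hs₂ hjk)
  have hWs (k : ℕ) := (s k).2.2.2 _ (Nat.le_add_right (s k).1.1 k)
  have hsub : Set.range a ⊆ ⋃ k, W k := by
    rintro _ ⟨k, rfl⟩
    exact Set.mem_iUnion.2 ⟨k, Or.inl ⟨k, Set.mem_Iic.2 (Nat.le_add_left _ _), rfl⟩⟩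
  have hcl : Substructure.closure L (⋃ k, W k) = B := by
    refine le_antisymm (closure_le.2 (Set.iUnion_subset fun k => closure_le.1 (hWs k).2.le))
      fun b hb => ?_
    obtain ⟨k, hk⟩ := he ⟨b, hb⟩
    have := hnext₃ (s k) (e k)
    rw [← hs] at this
    refine closure_mono ?_ (by simpa [hk] using this)
    refine (Set.union_subset_union_left _ (Set.image_mono (Set.Iic_subset_Iic.2
      (Nat.le_add_right _ (k + 1))))).trans (Set.subset_iUnion W (k + 1))
  exact freeFactor_iff.2 ⟨hBmem, _, _, hsub, isIndep_iUnion hW fun k => (hWs k).1, rfl, hcl⟩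

/-! ### Back from the monster model to the Construction Principle -/

theorem FreeFactor.of_map [L.IsAlgebraic] {N : Type u} [L.Structure N] (f : M ↪[L] N)
    {A B : L.Substructure M} (h : V.FreeFactor (A.map f.toHom) (B.map f.toHom)) :
    V.FreeFactor A B := by
  obtain ⟨hB, X, Y, hXY, hY, hX, hYB⟩ := freeFactor_iff.1 h
  have hYr : f '' (f ⁻¹' Y) = Y := Set.image_preimage_eq_of_subset fun y hy => by
    obtain ⟨x, -, hx⟩ := (hYB.le (subset_closure hy) : y ∈ B.map f.toHom)
    exact ⟨x, hx⟩
  have hXr : f '' (f ⁻¹' X) = X := Set.image_preimage_eq_of_subset fun y hy => by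
    obtain ⟨x, -, hx⟩ := (hYB.le (subset_closure (hXY hy)) : y ∈ B.map f.toHom)
    exact ⟨x, hx⟩
  have hinj := Substructure.map_injective_of_injective (f := f.toHom) f.injective
  refine freeFactor_iff.2 ⟨(mem_map_iff f).1 hB, f ⁻¹' X, f ⁻¹' Y, Set.preimage_mono hXY,
    (isIndep_image_iff f).1 (by rwa [hYr]), hinj ?_, hinj ?_⟩
  · exact (Substructure.map_closure f.toHom _).trans ((congrArg _ hXr).trans hX)
  · exact (Substructure.map_closure f.toHom _).trans ((congrArg _ hYr).trans hYB)

/-- The free algebra of rank 0 is neutral for the free product. -/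
theorem isFreeProduct_closure_empty [L.IsAlgebraic] {X : Set M} (hX : V.IsIndep X)
    (h : V.Mem (Substructure.closure L X)) :
    V.IsFreeProduct (Substructure.closure L X) (Substructure.closure L ∅)
      (Substructure.closure L X) := by
  have := IsIndep.isFreeProduct (V := V) (X := X) (Y := ∅) (by rwa [Set.union_empty])
    (Set.disjoint_empty X) (by rwa [Set.union_empty])
  simpa only [Set.union_empty] using this

end AlgVariety

theorem theorem1p10 {L : FirstOrder.Language.{v, w}} [L.IsAlgebraic]
    [Countable (Σ n, L.Functions n)]
    (V : AlgVariety L) (hV : AlgVariety.ConstructionPrinciple.{u} V)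
    (K : StrongClass.{u} L) (hK : K.IsAECCovering V)
    (lam κ : Cardinal.{u}) (hlam : K.IsLSNumber lam) (hκ : lam < κ)
    (M : Type u) [L.Structure M] (hM : K.IsMonster κ M)
    (ind : TernaryRel L M) (hind : IsWeakIndependenceCalculus K κ M ind)
    (hnice : IsNiceFreeFactors V K κ M ind) :
    ¬ SuperstableLocalCharacter K κ M ind := by
  intro hss
  obtain ⟨B, _, A, a, hBc, hBinf, hainj, haA, hfac, hnot⟩ := hV
  have hℵκ : ℵ₀ < κ := hlam.1.trans_lt hκ
  obtain ⟨f, hf⟩ := hM.universal B (hK.mem_of_isFreeInf B hBinf)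
    ((Cardinal.mk_le_aleph0_iff.2 hBc).trans hℵκ.le)
  have hrange : f.toHom.range = (⊤ : L.Substructure B).map f.toHom := Hom.range_eq_map _
  have hcount : Countable f.toHom.range := by
    rw [← SetLike.coe_sort_coe, Hom.range_coe]
    exact (Set.countable_range _).to_subtype
  have hsmall : K.Small κ f.toHom.range := ⟨hf, (Cardinal.mk_le_aleph0_iff.2 hcount).trans_lt hℵκ⟩
  have hA : Substructure.closure L (Set.range fun i => (a i : B)) = A := by
    refine Eq.trans ?_ (AlgVariety.closure_coe_image _ haA.2.1)
    rw [← Set.range_comp]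
    rfl
  have hAi : V.IsIndep (Set.range fun i => (a i : B)) := by
    have := haA.isIndep
    rwa [← Set.range_comp] at this
  have himage (i : ℕ) : (fun i => f (a i)) '' Set.Iic i = f '' {x : B | ∃ j ≤ i, x = (a j : B)} := by
    ext x
    simp only [Set.mem_image, Set.mem_Iic, Set.mem_ofPred_eq]
    constructor
    · rintro ⟨j, hj, rfl⟩
      exact ⟨_, ⟨j, hj, rfl⟩, rfl⟩
    · rintro ⟨_, ⟨j, hj, rfl⟩, rfl⟩
      exact ⟨j, hj, rfl⟩
  have key := AlgVariety.freeFactor_of_forall_initial_segment hK hind hnice hss hsmall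
    (a := fun i => f (a i)) (fun i j hij => hainj (Subtype.ext (f.injective hij))) fun i => by
      rw [himage]
      refine ⟨(AlgVariety.isIndep_image_iff f).2 (hAi.mono ?_), ?_⟩
      · rintro _ ⟨j, -, rfl⟩
        exact ⟨j, rfl⟩
      · have := (hfac i).map f
        rwa [Substructure.map_closure, ← hrange] at this
  have hmap : Substructure.closure L (Set.range fun i => f (a i)) = A.map f.toHom := by
    refine Eq.trans ?_ (congrArg (Substructure.map f.toHom) hA)
    rw [Substructure.map_closure, ← Set.range_comp]
    rfl
  rw [hmap, hrange] at key
  have hAB : V.FreeFactor A ⊤ := AlgVariety.FreeFactor.of_map f key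
  obtain ⟨hmem, -, Y, -, hY, -, hYtop⟩ := AlgVariety.freeFactor_iff.1 hAB
  have hrefl : (Embedding.refl L B).toHom.range = ⊤ := Hom.range_id
  -- Here `P = B`, embedded by the identity, and `C` is the subalgebra generated by the empty set,
  -- so `B * C` is `B` itself.
  refine hnot B (Embedding.refl L B) (Substructure.closure L ∅) ?_ ?_ ?_
  · exact AlgVariety.isFree_iff.2 ⟨AlgVariety.mem_of_le le_top hmem, ∅,
      hY.mono (Set.empty_subset _), rfl⟩
  · have := AlgVariety.isFreeProduct_closure_empty hY (hYtop ▸ hmem)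
    rwa [hrefl, ← hYtop]
  · rwa [show A.map (Embedding.refl L B).toHom = A from A.map_id]
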